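/- Let $\chi(\mathbb R^n)$ be the least number of colours needed to colour all points of Euclidean space $\mathbb R^n$ so that any two points at distance $1$ have different colours. A *multilattice* in $\mathbb R^n$ is a union $\Phi=\bigcup_{i=1}^{q}(\Omega+x_i)$ of $q=q(\Phi)\ge 1$ distinct translates of a (full-rank) lattice $\Omega$. A tiling $\Psi$ of $\mathbb R^n$ by convex polytopes, periodic with respect to $\Omega$, is *associated* with $\Phi$ if its tiles are in bijection $x\leftrightarrow\psi_x$ with the points of $\Phi$ in such a way that $x\in\operatorname{int}\psi_x$ for every $x\in\Phi$. For a bounded closed centrally symmetric convex body $K$ put $$\gamma(K,\Phi,\Psi)=\inf\{\beta/\alpha:\ \alpha,\beta>0,\ \alpha K+x\subseteq\psi_x\subseteq\beta K+x\ \text{ for all }x\in\Phi\},\qquad \gamma(K,k)=\inf_{q(\Phi)\le k}\gamma(K,\Phi,\Psi),$$ where the last infimum is over all multilattices $\Phi$ with $q(\Phi)\le k$ and all tilings $\Psi$ associated with them. Let $B^n$ be the closed Euclidean unit ball. **Corollary.** (i) There is an absolute constant $c>0$ such that for every $n\ge 1$ there are a positive integer $k\le n^{cn}$ and a multilattice $\Phi=\bigcup_{i=1}^{k}(\Omega+x_i)$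 over the cube lattice $\Omega=(2\mathbb Z)^n$, with $k$ translates, such that the sets $B^n+x_i$ $(1\le i\le k)$ are pairwise disjoint modulo $\Omega$ and the doubled balls cover the space: $\bigcup_{x\in\Phi}(2B^n+x)=\mathbb R^n$. Moreover, $\gamma(B^n,k)\le 2$ for this $k$. (ii) $\chi(\mathbb R^n)\le(3+o(1))^n$ as $n\to\infty$; that is, there is a sequence $\varepsilon_n\to0$ with $\chi(\mathbb R^n)\le(3+\varepsilon_n)^n$ for all $n$. -/

import Mathlib

open Set Filter Topology Metric
open scoped Pointwise ENNReal

/-- The graph on `ℝⁿ` (with the Euclidean metric) joining the pairs of points at distance `1`. -/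
def unitDistanceGraph (n : ℕ) : SimpleGraph (EuclideanSpace ℝ (Fin n)) where
  Adj x y := dist x y = 1
  symm := ⟨fun x y h => by rw [dist_comm]; exact h⟩
  loopless := ⟨fun x h => by simp at h⟩

/-- The chromatic number `χ(ℝⁿ)`: the least number of colours in a colouring of all points in which
any two points at distance `1` have different colours. -/
noncomputable def chromaticNumberSpace (n : ℕ) : ℕ∞ :=
  (unitDistanceGraph n).chromaticNumber

/-- A multilattice in `ℝⁿ`, given by its base lattice `Ω` (discrete, of full rank) and by finitely
many (at least one) translation vectors, no two of which are congruent modulo `Ω`. -/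
structure Multilattice (n : ℕ) where
  lattice : Submodule ℤ (EuclideanSpace ℝ (Fin n))
  discrete : DiscreteTopology lattice
  full : IsZLattice ℝ lattice
  shifts : Finset (EuclideanSpace ℝ (Fin n))
  shifts_nonempty : shifts.Nonempty
  shifts_incongruent : ∀ x ∈ shifts, ∀ y ∈ shifts, x - y ∈ lattice → x = y

namespace Multilattice

/-- The point set `⋃ᵢ (Ω + xᵢ)`. -/
def points {n : ℕ} (M : Multilattice n) : Set (EuclideanSpace ℝ (Fin n)) :=
  ⋃ x ∈ M.shifts, x +ᵥ (M.lattice : Set (EuclideanSpace ℝ (Fin n)))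

/-- The number `q` of translates of the base lattice. -/
def q {n : ℕ} (M : Multilattice n) : ℕ := M.shifts.card

end Multilattice

/-- A convex polytope: a bounded intersection of finitely many closed half-spaces. -/
def IsConvexPolytope {n : ℕ} (P : Set (EuclideanSpace ℝ (Fin n))) : Prop :=
  Bornology.IsBounded P ∧
    ∃ H : Finset (EuclideanSpace ℝ (Fin n) × ℝ), P = {z | ∀ h ∈ H, inner ℝ h.1 z ≤ h.2}

/-- A tiling of `ℝⁿ` by convex polytopes associated with the multilattice `M`: the tiles are indexed
by the points of `M`, every point lies in the interior of its tile, and the tiling is periodic with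
respect to the base lattice. -/
structure AssociatedTiling {n : ℕ} (M : Multilattice n) where
  tile : M.points → Set (EuclideanSpace ℝ (Fin n))
  polytope : ∀ x, IsConvexPolytope (tile x)
  mem_interior : ∀ x, (x : EuclideanSpace ℝ (Fin n)) ∈ interior (tile x)
  cover : (⋃ x, tile x) = univ
  disjoint_interior : ∀ x y, x ≠ y → Disjoint (interior (tile x)) (interior (tile y))
  periodic : ∀ x y : M.points, ((y : EuclideanSpace ℝ (Fin n)) - x) ∈ M.lattice →
    tile y = ((y : EuclideanSpace ℝ (Fin n)) - x) +ᵥ tile x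

/-- The tiling parameter `γ(K, Φ, Ψ)`, the infimum of the ratios `β / α` with `α, β > 0` such that
`αK + x ⊆ ψₓ ⊆ βK + x` for all points `x` (it is `∞` if there are none). -/
noncomputable def tilingParameterOf {n : ℕ} (K : Set (EuclideanSpace ℝ (Fin n)))
    (M : Multilattice n) (T : AssociatedTiling M) : ℝ≥0∞ :=
  sInf {r : ℝ≥0∞ | ∃ α β : ℝ, 0 < α ∧ 0 < β ∧ r = ENNReal.ofReal (β / α) ∧
    ∀ x : M.points, (x : EuclideanSpace ℝ (Fin n)) +ᵥ (α • K) ⊆ T.tile x ∧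
      T.tile x ⊆ (x : EuclideanSpace ℝ (Fin n)) +ᵥ (β • K)}

/-- `γ(K, k)`: the infimum of the tiling parameters over all multilattices with at most `k`
translates and all tilings associated with them. -/
noncomputable def tilingParameter {n : ℕ} (K : Set (EuclideanSpace ℝ (Fin n))) (k : ℕ) : ℝ≥0∞ :=
  ⨅ (M : Multilattice n) (_ : M.q ≤ k) (T : AssociatedTiling M), tilingParameterOf K M T

/-- The lattice `(2ℤ)ⁿ` generated by the edges of an axis-parallel cube of side length `2`. -/
noncomputable def cubeLattice (n : ℕ) : Submodule ℤ (EuclideanSpace ℝ (Fin n)) :=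
  Submodule.span ℤ (range fun i : Fin n => EuclideanSpace.single i (2 : ℝ))

/-! A maximal set of points pairwise more than 2 apart modulo `(2ℤ)ⁿ` gives a multilattice of
packing radius at least 1 and covering radius at most 2. Each Voronoi cell lies between concentric
balls of radii 1 and 2, so the Voronoi tiling shows `γ(Bⁿ, k) ≤ 2`.

For the colouring, contract every cell by `μ` towards its centre. Points of one contracted cell are
at most `4μ` apart, points of different ones at least `2(1 - μ)`. Both bounds equal `4/3` at `μ =
1/3`, so for `μ = 1/3 - η` the union of contracted cells avoids distance `4/3`, with room to spare
(`le_dist_homothety_voronoiCell`, `dist_le_or_le_dist_of_mem_contractedCells`).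

This union has density `μⁿ`. By averaging, some translate captures that proportion of any finite set
(`exists_translate_card_le`), so a greedy choice of about `μ⁻ⁿ log(mⁿ)` translates covers a grid of
at most `mⁿ` points modulo the lattice (`exists_cover_of_proportion`). The room absorbs the passage
from grid points to all points, and each translate serves as a colour. With `η` of order `1/n` and
`m` polynomial in `n`, the count is `3ⁿ` times a polynomial. -/

open MeasureTheory

/-! ### Voronoi cells of separated and relatively dense sets -/

section Voronoi

variable {V : Type*} [NormedAddCommGroup V]

/-- The Voronoi cell of `x` with respect to the point set `X`. -/
def voronoiCell (X : Set V) (x : V) : Set V := {z | ∀ y ∈ X, dist z x ≤ dist z y}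

theorem isClosed_voronoiCell (X : Set V) (x : V) : IsClosed (voronoiCell X x) := by
  simp only [voronoiCell, ofPred_forall]
  exact isClosed_biInter fun y _ => isClosed_le (by fun_prop) (by fun_prop)

theorem voronoiCell_subset_closedBall {X : Set V} {r : ℝ} (hcov : ∀ z, ∃ y ∈ X, dist z y ≤ r)
    (x : V) : voronoiCell X x ⊆ closedBall x r := by
  intro z hz
  obtain ⟨y, hy, h⟩ := hcov z
  exact (hz y hy).trans h

theorem closedBall_subset_voronoiCell {X : Set V} {r : ℝ}
    (hsep : X.Pairwise fun x y => 2 * r ≤ dist x y) {x : V} (hx : x ∈ X) :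
    closedBall x r ⊆ voronoiCell X x := by
  intro z hz y hy
  rcases eq_or_ne x y with rfl | hxy
  · exact le_rfl
  · have h1 := hsep hx hy hxy
    have h2 := dist_triangle_left x y z
    rw [mem_closedBall] at hz
    linarith

theorem voronoiCell_vadd {X : Set V} {v : V} (hX : ∀ y, v + y ∈ X ↔ y ∈ X) (x : V) :
    voronoiCell X (v + x) = v +ᵥ voronoiCell X x := by
  ext z
  rw [mem_vadd_set_iff_neg_vadd_mem]
  have key : ∀ y, dist (-v +ᵥ z) y = dist z (v + y) := fun y => by
    rw [vadd_eq_add, dist_eq_norm, dist_eq_norm]; congr 1; abel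
  simp only [voronoiCell, mem_ofPred_eq, key]
  refine ⟨fun h y hy => h _ ((hX y).2 hy), fun h y hy => ?_⟩
  have := h (-v + y) ((hX _).1 (by simpa using hy))
  simpa using this

theorem finite_inter_closedBall_of_separated [ProperSpace V] {X : Set V} {s : ℝ} (hs : 0 < s)
    (hsep : X.Pairwise fun x y => s ≤ dist x y) (x : V) (r : ℝ) : (X ∩ closedBall x r).Finite := by
  rw [inter_comm]
  refine Metric.finite_isBounded_inter_isClosed ⟨?_⟩ isBounded_closedBall
    (Metric.isClosed_of_pairwise_le_dist hs hsep)
  exact DiscreteTopology.of_forall_le_dist hs fun a b hab =>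
    hsep a.2 b.2 (Subtype.coe_injective.ne hab)

theorem exists_mem_voronoiCell [ProperSpace V] {X : Set V} {s : ℝ} (hs : 0 < s)
    (hsep : X.Pairwise fun x y => s ≤ dist x y) (hne : X.Nonempty) (z : V) :
    ∃ x ∈ X, z ∈ voronoiCell X x := by
  obtain ⟨x, hx, h⟩ := (Metric.isClosed_of_pairwise_le_dist hs hsep).exists_infDist_eq_dist hne z
  exact ⟨x, hx, fun y hy => h ▸ infDist_le_dist_of_mem hy⟩

variable [InnerProductSpace ℝ V]

/-- Squaring cancels `‖z‖²`, leaving a condition linear in `z`; hence Voronoi cells are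
intersections of half-spaces. -/
theorem dist_le_dist_iff_inner_le (x y z : V) :
    dist z x ≤ dist z y ↔ inner ℝ (y - x) z ≤ (‖y‖ ^ 2 - ‖x‖ ^ 2) / 2 := by
  rw [dist_eq_norm, dist_eq_norm, ← sq_le_sq₀ (norm_nonneg _) (norm_nonneg _),
    norm_sub_sq_real, norm_sub_sq_real, inner_sub_left, real_inner_comm z x, real_inner_comm z y]
  constructor <;> intro h <;> linarith

/-- A point in the cell of `x` lies on the near side of the bisector of `x` and `y`. -/
theorem inner_sub_le_of_mem_voronoiCell {X : Set V} {x y z : V} (hz : z ∈ voronoiCell X x)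
    (hy : y ∈ X) : inner ℝ (y - x) (z - x) ≤ ‖y - x‖ ^ 2 / 2 := by
  have h := (dist_le_dist_iff_inner_le x y z).1 (hz y hy)
  have h2 := norm_sub_sq_real y x
  rw [inner_sub_right, inner_sub_left y x x, real_inner_self_eq_norm_sq]
  linarith

/-- Points of distinct cells, each contracted by the factor `μ` towards its centre, are far from
each other. -/
theorem le_dist_homothety_voronoiCell {X : Set V} {x y z w : V} {μ : ℝ} (hμ : 0 ≤ μ) (hx : x ∈ X)
    (hy : y ∈ X) (hz : z ∈ voronoiCell X x) (hw : w ∈ voronoiCell X y) :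
    (1 - μ) * dist x y ≤ dist (AffineMap.homothety x μ z) (AffineMap.homothety y μ w) := by
  rcases eq_or_ne x y with rfl | hxy
  · simp
  have hpos : 0 < ‖y - x‖ := norm_pos_iff.2 (sub_ne_zero.2 hxy.symm)
  have h1 := inner_sub_le_of_mem_voronoiCell hz hy
  have h2 := inner_sub_le_of_mem_voronoiCell hw hx
  have h3 : inner ℝ (x - y) (w - y) = -inner ℝ (y - x) (w - y) := by
    rw [← inner_neg_left, neg_sub]
  rw [h3, norm_sub_rev] at h2
  have h4 := real_inner_le_norm (y - x)
    (AffineMap.homothety y μ w - AffineMap.homothety x μ z)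
  have h5 : AffineMap.homothety y μ w - AffineMap.homothety x μ z
      = (y - x) + (μ • (w - y) - μ • (z - x)) := by
    simp only [AffineMap.homothety_apply, vsub_eq_sub, vadd_eq_add]; abel
  rw [dist_comm (AffineMap.homothety x μ z), dist_eq_norm (AffineMap.homothety y μ w), dist_comm,
    dist_eq_norm]
  have h6 : inner ℝ (y - x) (AffineMap.homothety y μ w - AffineMap.homothety x μ z)
      = ‖y - x‖ ^ 2 + μ * inner ℝ (y - x) (w - y) - μ * inner ℝ (y - x) (z - x) := by
    rw [h5, inner_add_right, real_inner_self_eq_norm_sq, inner_sub_right, real_inner_smul_right,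
      real_inner_smul_right]; ring
  rw [h6] at h4
  refine le_of_mul_le_mul_left ?_ hpos
  nlinarith [mul_le_mul_of_nonneg_left h1 hμ, mul_le_mul_of_nonneg_left h2 hμ]

/-- If every point is within distance `r` of `X`, then the Voronoi cell of `x` is determined by the
points of `X` within distance `5 r / 2` of `x`. -/
theorem voronoiCell_inter_closedBall {X : Set V} {r : ℝ} (hr : 0 < r)
    (hcov : ∀ z, ∃ y ∈ X, dist z y ≤ r) (x : V) :
    voronoiCell (X ∩ closedBall x (5 / 2 * r)) x = voronoiCell X x := by
  refine Subset.antisymm (fun z hz => ?_) fun z hz y hy => hz y hy.1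
  have hzr : dist z x ≤ r := by
    by_contra! hlt
    set d := dist z x with hd
    have hd0 : 0 < d := hr.trans hlt
    -- If `z` were farther than `r` from `x`, a point `w` of the segment from `x` to `z` would have
    -- distance in `(r, 3r/2]` from `x`. A point `y` of `X` within `r` of `w` lies within `5r/2` of
    -- `x`, so its half-space is among the retained ones; it contains both `x` and `z`, hence `w`,
    -- which contradicts `dist w y ≤ r < dist w x`.
    obtain ⟨t, ht0, ht1, htr, htr'⟩ : ∃ t : ℝ, 0 ≤ t ∧ t ≤ 1 ∧ r < t * d ∧ t * d ≤ 3 / 2 * r := by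
      refine ⟨min d (3 / 2 * r) / d, by positivity, ?_, ?_, ?_⟩
      · rw [div_le_one hd0]; exact min_le_left _ _
      · rw [div_mul_cancel₀ _ hd0.ne']; exact lt_min hlt (by linarith)
      · rw [div_mul_cancel₀ _ hd0.ne']; exact min_le_right _ _
    set w := x + t • (z - x) with hw
    have hwx : dist w x = t * d := by
      rw [hw, hd, dist_eq_norm, dist_eq_norm, add_sub_cancel_left, norm_smul, Real.norm_of_nonneg ht0]
    obtain ⟨y, hy, hwy⟩ := hcov w
    have hyx : dist y x ≤ 5 / 2 * r := by
      have := dist_triangle_left y x w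
      linarith
    have h := inner_sub_le_of_mem_voronoiCell hz (y := y) ⟨hy, hyx⟩
    have h2 : dist w x ≤ dist w y := by
      rw [dist_eq_norm, dist_eq_norm, ← sq_le_sq₀ (norm_nonneg _) (norm_nonneg _)]
      have e1 : w - x = t • (z - x) := by rw [hw, add_sub_cancel_left]
      have e2 : w - y = t • (z - x) - (y - x) := by rw [← e1]; abel
      rw [e2, e1, norm_sub_sq_real, real_inner_smul_left, real_inner_comm]
      nlinarith [sq_nonneg ‖y - x‖]
    linarith
  intro y hy
  by_contra! hlt
  have := dist_triangle_left y x z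
  exact absurd (hz y ⟨hy, by rw [mem_closedBall]; linarith⟩) (not_le.2 hlt)

/-- A common interior point lies on the bisector of `x` and `y`; a small push in the direction `y -
x` takes it strictly to the side of `y`, out of the cell of `x`. -/
theorem disjoint_interior_voronoiCell {X : Set V} {x y : V} (hx : x ∈ X) (hy : y ∈ X)
    (hxy : x ≠ y) : Disjoint (interior (voronoiCell X x)) (interior (voronoiCell X y)) := by
  rw [Set.disjoint_left]
  intro z hzx hzy
  have hnhds := inter_mem (mem_interior_iff_mem_nhds.1 hzx) (mem_interior_iff_mem_nhds.1 hzy)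
  have hlim : Tendsto (fun t : ℝ => z + t • (y - x)) (𝓝[>] 0) (𝓝 z) := by
    have : ContinuousAt (fun t : ℝ => z + t • (y - x)) 0 := by fun_prop
    have h := this.tendsto
    simp only [zero_smul, add_zero] at h
    exact h.mono_left nhdsWithin_le_nhds
  obtain ⟨t, ⟨h1, -⟩, ht⟩ := ((hlim.eventually hnhds).and self_mem_nhdsWithin).exists
  have h1 := (dist_le_dist_iff_inner_le x y _).1 (h1 y hy)
  have h2 := (dist_le_dist_iff_inner_le y x z).1 (interior_subset hzy x hx)
  have h3 : inner ℝ (x - y) z = -inner ℝ (y - x) z := by rw [← inner_neg_left, neg_sub]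
  rw [inner_add_right, real_inner_smul_right, real_inner_self_eq_norm_sq] at h1
  have hpos : 0 < ‖y - x‖ := norm_pos_iff.2 (sub_ne_zero.2 hxy.symm)
  have : 0 < t * ‖y - x‖ ^ 2 := mul_pos ht (by positivity)
  linarith

/-- Only the bisectors with points within `5r/2` matter, and separation leaves finitely many of
these. -/
theorem isConvexPolytope_voronoiCell {n : ℕ} {X : Set (EuclideanSpace ℝ (Fin n))} {r s : ℝ}
    (hs : 0 < s) (hr : 0 < r) (hsep : X.Pairwise fun x y => s ≤ dist x y)
    (hcov : ∀ z, ∃ y ∈ X, dist z y ≤ r) (x : EuclideanSpace ℝ (Fin n)) :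
    IsConvexPolytope (voronoiCell X x) := by
  classical
  refine ⟨isBounded_closedBall.subset (voronoiCell_subset_closedBall hcov x), ?_⟩
  have hfin := finite_inter_closedBall_of_separated hs hsep x (5 / 2 * r)
  refine ⟨hfin.toFinset.image fun y => (y - x, (‖y‖ ^ 2 - ‖x‖ ^ 2) / 2), ?_⟩
  rw [← voronoiCell_inter_closedBall hr hcov x]
  ext z
  simp only [voronoiCell, dist_le_dist_iff_inner_le, mem_ofPred_eq, Finset.forall_mem_image,
    Finite.mem_toFinset]

end Voronoi

/-! ### The Voronoi tiling of a multilattice -/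

namespace Multilattice

variable {n : ℕ} {M : Multilattice n}

theorem mem_points {z : EuclideanSpace ℝ (Fin n)} :
    z ∈ M.points ↔ ∃ x ∈ M.shifts, ∃ l ∈ M.lattice, l + x = z := by
  simp only [points, mem_iUnion, mem_vadd_set, SetLike.mem_coe, vadd_eq_add, exists_prop,
    add_comm]

theorem add_mem_points_iff {l : EuclideanSpace ℝ (Fin n)} (hl : l ∈ M.lattice)
    (y : EuclideanSpace ℝ (Fin n)) : l + y ∈ M.points ↔ y ∈ M.points := by
  simp only [mem_points]
  constructor
  · rintro ⟨x, hx, m, hm, h⟩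
    exact ⟨x, hx, m - l, sub_mem hm hl, by rw [sub_add_eq_add_sub, h, add_sub_cancel_left]⟩
  · rintro ⟨x, hx, m, hm, rfl⟩
    exact ⟨x, hx, l + m, add_mem hl hm, add_assoc _ _ _⟩

theorem points_nonempty : M.points.Nonempty := by
  obtain ⟨x, hx⟩ := M.shifts_nonempty
  exact ⟨x, mem_points.2 ⟨x, hx, 0, zero_mem _, zero_add _⟩⟩

/-- The Voronoi tiling of a multilattice with packing radius at least `1` and covering radius at
most `2`. -/
def voronoiTiling (hsep : M.points.Pairwise fun x y => 2 ≤ dist x y)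
    (hcov : ∀ z, ∃ y ∈ M.points, dist z y ≤ 2) : AssociatedTiling M where
  tile x := voronoiCell M.points x
  polytope x := isConvexPolytope_voronoiCell two_pos two_pos hsep hcov x
  mem_interior x := by
    rw [mem_interior_iff_mem_nhds]
    exact mem_of_superset (closedBall_mem_nhds _ one_pos)
      (closedBall_subset_voronoiCell (by simpa using hsep) x.2)
  cover := by
    refine eq_univ_of_forall fun z => mem_iUnion.2 ?_
    obtain ⟨x, hx, h⟩ := exists_mem_voronoiCell two_pos hsep points_nonempty z
    exact ⟨⟨x, hx⟩, h⟩
  disjoint_interior x y hxy :=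
    disjoint_interior_voronoiCell x.2 y.2 (Subtype.coe_injective.ne hxy)
  periodic x y h := by
    rw [← voronoiCell_vadd (add_mem_points_iff h), sub_add_cancel]

theorem tilingParameter_closedBall_le_two
    (hsep : M.points.Pairwise fun x y => 2 ≤ dist x y)
    (hcov : ∀ z, ∃ y ∈ M.points, dist z y ≤ 2) :
    tilingParameter (closedBall (0 : EuclideanSpace ℝ (Fin n)) 1) M.q ≤ 2 := by
  refine iInf_le_of_le M (iInf_le_of_le le_rfl
    (iInf_le_of_le (voronoiTiling hsep hcov) (sInf_le ?_)))
  refine ⟨1, 2, one_pos, two_pos, by simp, fun x => ⟨?_, ?_⟩⟩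
  · simpa [voronoiTiling] using closedBall_subset_voronoiCell (r := 1) (by simpa using hsep) x.2
  · have h := voronoiCell_subset_closedBall hcov (x : EuclideanSpace ℝ (Fin n))
    simpa [_root_.smul_closedBall, voronoiTiling] using h

end Multilattice

/-! ### Maximal packings modulo the cube lattice -/

section CubeLattice

variable {n : ℕ}

/-- The basis `(2 eᵢ)` of `ℝⁿ`. -/
noncomputable def cubeBasis (n : ℕ) : Module.Basis (Fin n) ℝ (EuclideanSpace ℝ (Fin n)) :=
  (EuclideanSpace.basisFun (Fin n) ℝ).toBasis.isUnitSMul (w := fun _ => (2 : ℝ))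
    fun _ => isUnit_iff_ne_zero.2 two_ne_zero

theorem cubeLattice_eq_span (n : ℕ) :
    cubeLattice n = Submodule.span ℤ (range (cubeBasis n)) := by
  have h : (fun i : Fin n => EuclideanSpace.single i (2 : ℝ)) = cubeBasis n := by
    funext i
    ext j
    simp [cubeBasis, Module.Basis.isUnitSMul_apply]
  rw [cubeLattice, h]

instance : DiscreteTopology (cubeLattice n) := by
  rw [cubeLattice_eq_span]; infer_instance

instance : IsZLattice ℝ (cubeLattice n) := by
  simp only [cubeLattice_eq_span]; infer_instance

theorem mem_cubeLattice_of_coord {z : EuclideanSpace ℝ (Fin n)} (a : Fin n → ℤ)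
    (h : ∀ i, z i = 2 * a i) : z ∈ cubeLattice n := by
  have hz : z = ∑ i, a i • EuclideanSpace.single i (2 : ℝ) := by
    ext j
    rw [h, WithLp.ofLp_sum, Finset.sum_apply, Finset.sum_eq_single j]
    · simp [mul_comm]
    · intro i _ hij; simp [hij.symm]
    · simp
  rw [hz]
  exact Submodule.sum_mem _ fun i _ =>
    Submodule.smul_mem _ _ (Submodule.subset_span (mem_range_self i))

theorem exists_coord_of_mem_cubeLattice {z : EuclideanSpace ℝ (Fin n)} (hz : z ∈ cubeLattice n)
    (i : Fin n) : ∃ a : ℤ, z i = 2 * a := by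
  induction hz using Submodule.span_induction with
  | mem x hx =>
    obtain ⟨j, rfl⟩ := hx
    rcases eq_or_ne j i with rfl | h
    · exact ⟨1, by simp⟩
    · exact ⟨0, by simp [h.symm]⟩
  | zero => exact ⟨0, by simp⟩
  | add x y _ _ hx hy =>
    obtain ⟨a, ha⟩ := hx
    obtain ⟨b, hb⟩ := hy
    exact ⟨a + b, by rw [PiLp.add_apply, ha, hb]; push_cast; ring⟩
  | smul c x _ hx =>
    obtain ⟨a, ha⟩ := hx
    exact ⟨c * a, by rw [PiLp.smul_apply, ha, zsmul_eq_mul]; push_cast; ring⟩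

/-- This separates the lattice translates of a single point, which `SeparatedModCube` does not
control. -/
theorem two_le_norm_of_mem_cubeLattice {z : EuclideanSpace ℝ (Fin n)} (hz : z ∈ cubeLattice n)
    (h0 : z ≠ 0) : 2 ≤ ‖z‖ := by
  obtain ⟨i, hi⟩ : ∃ i, z i ≠ 0 := by
    by_contra! h
    exact h0 (by ext i; simpa using h i)
  obtain ⟨a, ha⟩ := exists_coord_of_mem_cubeLattice hz i
  refine le_trans ?_ (PiLp.norm_apply_le z i)
  have ha0 : a ≠ 0 := by rintro rfl; simp [ha] at hi
  have : (1 : ℝ) ≤ |(a : ℝ)| := by exact_mod_cast Int.one_le_abs ha0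
  rw [ha, Real.norm_eq_abs, abs_mul, abs_two]
  linarith

/-- The torus `ℝⁿ / (2ℤ)ⁿ` splits into `mⁿ` cubes with sides of length `2 / m`. -/
theorem exists_grid_partition (n : ℕ) {m : ℕ} (hm : 0 < m) :
    ∃ f : EuclideanSpace ℝ (Fin n) → (Fin n → ZMod m), ∀ z w, f z = f w →
      ∃ l ∈ cubeLattice n, dist z (l + w) ≤ 2 / m * √n := by
  have hm' : (0 : ℝ) < m := by exact_mod_cast hm
  -- The label records, coordinatewise, the interval of length `2 / m`; reduction modulo `m`
  -- identifies intervals that differ by a multiple of 2.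
  refine ⟨fun z i => (⌊z i * m / 2⌋ : ℤ), fun z w h => ?_⟩
  have h1 : ∀ i, ∃ a : ℤ, ⌊z i * m / 2⌋ - ⌊w i * m / 2⌋ = m * a := fun i => by
    have h := congrFun h i
    exact (ZMod.intCast_eq_intCast_iff_dvd_sub _ _ m).1 h.symm
  choose a ha using h1
  refine ⟨WithLp.toLp 2 fun i => 2 * (a i : ℝ), mem_cubeLattice_of_coord a fun i => rfl, ?_⟩
  rw [EuclideanSpace.dist_eq]
  have hcoord : ∀ i, dist (z i) (2 * (a i : ℝ) + w i) ≤ 2 / m := fun i => by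
    have h2 : (⌊z i * m / 2⌋ : ℝ) - ⌊w i * m / 2⌋ = m * a i := by exact_mod_cast ha i
    have h3 := Int.floor_le (z i * m / 2)
    have h4 := Int.lt_floor_add_one (z i * m / 2)
    have h5 := Int.floor_le (w i * m / 2)
    have h6 := Int.lt_floor_add_one (w i * m / 2)
    rw [Real.dist_eq, abs_le, le_div_iff₀ hm', ← neg_div, div_le_iff₀ hm']
    constructor <;> linarith
  calc √(∑ i, dist (z i) (2 * (a i : ℝ) + w i) ^ 2)
      ≤ √(∑ _i : Fin n, (2 / (m : ℝ)) ^ 2) :=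
        Real.sqrt_le_sqrt (Finset.sum_le_sum fun i _ =>
          pow_le_pow_left₀ dist_nonneg (hcoord i) 2)
    _ = 2 / m * √n := by
        rw [Finset.sum_const, Finset.card_univ, Fintype.card_fin, nsmul_eq_mul, mul_comm,
          Real.sqrt_mul (by positivity), Real.sqrt_sq (by positivity)]

/-- A finite set of at most `mⁿ` points which is `2 √n / m`-dense modulo `(2ℤ)ⁿ`. -/
theorem exists_finset_dense_mod_cubeLattice (n : ℕ) {m : ℕ} (hm : 0 < m) :
    ∃ P : Finset (EuclideanSpace ℝ (Fin n)), P.card ≤ m ^ n ∧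
      ∀ z, ∃ p ∈ P, ∃ l ∈ cubeLattice n, dist z (l + p) ≤ 2 / m * √n := by
  classical
  have : NeZero m := ⟨hm.ne'⟩
  obtain ⟨f, hf⟩ := exists_grid_partition n hm
  -- One representative per cube; a label that `f` does not attain contributes an arbitrary point,
  -- which is harmless.
  refine ⟨Finset.univ.image (Function.invFun f), ?_, fun z => ?_⟩
  · refine Finset.card_image_le.trans ?_
    simp [ZMod.card]
  · refine ⟨Function.invFun f (f z), by simp, hf _ _ ?_⟩
    exact (Function.invFun_eq ⟨z, rfl⟩).symm

/-- Pairs of distinct points of `s` have distance more than `2` modulo `(2ℤ)ⁿ`. -/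
def SeparatedModCube (s : Finset (EuclideanSpace ℝ (Fin n))) : Prop :=
  ∀ x ∈ s, ∀ y ∈ s, x ≠ y → ∀ l ∈ cubeLattice n, 2 < dist x (l + y)

/-- Take `m = n` in the grid: points with one label are within `2√n / n ≤ 2` modulo the lattice, so
strict separation allows one point per label. -/
theorem SeparatedModCube.card_le {s : Finset (EuclideanSpace ℝ (Fin n))}
    (hs : SeparatedModCube s) (hn : 1 ≤ n) : s.card ≤ n ^ n := by
  classical
  have : NeZero n := ⟨by omega⟩
  obtain ⟨f, hf⟩ := exists_grid_partition n hn
  have hinj : Set.InjOn f s := fun x hx y hy hxy => by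
    by_contra hne
    obtain ⟨l, hl, h⟩ := hf x y hxy
    refine absurd (hs x hx y hy hne l hl) (not_lt.2 (h.trans ?_))
    have hn' : (1 : ℝ) ≤ n := by exact_mod_cast hn
    have h1 : √(n : ℝ) ≤ n := Real.sqrt_le_self_iff.2 (Or.inr hn')
    calc 2 / (n : ℝ) * √n ≤ 2 / n * n := by gcongr
      _ = 2 := by field_simp
  calc s.card ≤ (Finset.univ : Finset (Fin n → ZMod n)).card :=
        Finset.card_le_card_of_injOn f (by simp) hinj
    _ = n ^ n := by simp [ZMod.card]

/-- The bound `nⁿ` yields a separated set of maximal cardinality; an uncovered point could be added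
to it. -/
theorem exists_separatedModCube_covering (hn : 1 ≤ n) :
    ∃ s : Finset (EuclideanSpace ℝ (Fin n)), s.Nonempty ∧ SeparatedModCube s ∧
      ∀ z, ∃ x ∈ s, ∃ l ∈ cubeLattice n, dist z (l + x) ≤ 2 := by
  classical
  have hbdd : BddAbove {k | ∃ s : Finset (EuclideanSpace ℝ (Fin n)),
      SeparatedModCube s ∧ s.card = k} := ⟨n ^ n, by
    rintro _ ⟨s, hs, rfl⟩; exact hs.card_le hn⟩
  obtain ⟨s, hs, hcard⟩ := Nat.sSup_mem (by exact ⟨0, ∅, by simp [SeparatedModCube], rfl⟩) hbdd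
  have hcov : ∀ z, ∃ x ∈ s, ∃ l ∈ cubeLattice n, dist z (l + x) ≤ 2 := by
    intro z
    by_contra! hz
    have hzs : z ∉ s := fun h => by
      have := hz z h 0 (zero_mem _)
      rw [zero_add, dist_self] at this
      linarith
    have hins : SeparatedModCube (insert z s) := by
      intro x hx y hy hxy l hl
      rcases Finset.mem_insert.1 hx with rfl | hx' <;>
        rcases Finset.mem_insert.1 hy with rfl | hy'
      · exact absurd rfl hxy
      · exact hz y hy' l hl
      · have h := hz x hx' (-l) (neg_mem hl)
        rwa [dist_comm, dist_eq_norm, show -l + x - y = x - (l + y) by abel,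
          ← dist_eq_norm] at h
      · exact hs x hx' y hy' hxy l hl
    have h := le_csSup hbdd ⟨_, hins, rfl⟩
    rw [← hcard, Finset.card_insert_of_notMem hzs] at h
    omega
  obtain ⟨x, hx, -⟩ := hcov 0
  exact ⟨s, ⟨x, hx⟩, hs, hcov⟩

/-- A multilattice over `(2ℤ)ⁿ` with at most `nⁿ` translates, with packing radius at least `1` and
covering radius at most `2`. -/
theorem exists_multilattice_cubeLattice (hn : 1 ≤ n) :
    ∃ M : Multilattice n, M.lattice = cubeLattice n ∧ M.q ≤ n ^ n ∧ SeparatedModCube M.shifts ∧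
      (M.points.Pairwise fun x y => 2 ≤ dist x y) ∧ ∀ z, ∃ y ∈ M.points, dist z y ≤ 2 := by
  obtain ⟨s, hne, hs, hcov⟩ := exists_separatedModCube_covering hn
  refine ⟨⟨cubeLattice n, inferInstance, inferInstance, s, hne, fun x hx y hy hxy => ?_⟩, rfl,
    hs.card_le hn, hs, ?_, fun z => ?_⟩
  · by_contra hne
    have h := hs x hx y hy hne _ hxy
    rw [sub_add_cancel, dist_self] at h
    linarith
  · intro x hx y hy hxy
    obtain ⟨x, hxs, l, hl, rfl⟩ := Multilattice.mem_points.1 hx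
    obtain ⟨y, hys, m, hm, rfl⟩ := Multilattice.mem_points.1 hy
    rcases eq_or_ne x y with rfl | hne
    · rw [dist_add_right, dist_eq_norm]
      exact two_le_norm_of_mem_cubeLattice (sub_mem hl hm)
        (sub_ne_zero.2 fun h => hxy (by rw [h]))
    · have h := hs x hxs y hys hne (m - l) (sub_mem hm hl)
      rw [dist_eq_norm, show x - (m - l + y) = l + x - (m + y) by abel, ← dist_eq_norm] at h
      exact h.le
  · obtain ⟨x, hx, l, hl, h⟩ := hcov z
    exact ⟨_, Multilattice.mem_points.2 ⟨x, hx, l, hl, rfl⟩, h⟩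

theorem SeparatedModCube.disjoint {s : Finset (EuclideanSpace ℝ (Fin n))}
    (hs : SeparatedModCube s) {x y : EuclideanSpace ℝ (Fin n)} (hx : x ∈ s) (hy : y ∈ s)
    (hxy : x ≠ y) :
    Disjoint ((cubeLattice n : Set (EuclideanSpace ℝ (Fin n))) + closedBall x 1)
      ((cubeLattice n : Set (EuclideanSpace ℝ (Fin n))) + closedBall y 1) := by
  rw [Set.disjoint_left]
  rintro _ ⟨l, hl, u, hu, rfl⟩ ⟨m, hm, v, hv, huv⟩
  have h := hs x hx y hy hxy (m - l) (sub_mem hm hl)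
  rw [mem_closedBall, dist_eq_norm] at hu hv
  rw [dist_eq_norm, show x - (m - l + y) = (v - y) - (u - x) by
    have : m + v = l + u := huv
    rw [← sub_eq_zero] at this ⊢
    rw [← neg_eq_zero, ← this]; abel] at h
  linarith [norm_sub_le (v - y) (u - x)]

end CubeLattice

/-! ### Density of the contracted cells and covering by translates -/

section Density

variable {n : ℕ}

namespace Multilattice

/-- The union of the Voronoi cells of a multilattice, each contracted by the factor `μ` towards its
centre. -/
def contractedCells (M : Multilattice n) (μ : ℝ) : Set (EuclideanSpace ℝ (Fin n)) :=
  ⋃ x ∈ M.points, AffineMap.homothety x μ '' voronoiCell M.points x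

variable {M : Multilattice n}

theorem measurableSet_homothety_image_voronoiCell
    (hcov : ∀ z, ∃ y ∈ M.points, dist z y ≤ 2) (x : EuclideanSpace ℝ (Fin n)) (μ : ℝ) :
    MeasurableSet (AffineMap.homothety x μ '' voronoiCell M.points x) := by
  have hc : IsCompact (voronoiCell M.points x) :=
    (isCompact_closedBall x 2).of_isClosed_subset (isClosed_voronoiCell _ _)
      (voronoiCell_subset_closedBall hcov x)
  exact (hc.image (AffineMap.homothety_continuous x μ)).isClosed.measurableSet

theorem homothety_image_voronoiCell_vadd (l : M.lattice) (x : EuclideanSpace ℝ (Fin n)) (μ : ℝ) :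
    l +ᵥ (AffineMap.homothety x μ '' voronoiCell M.points x)
      = AffineMap.homothety ((l : EuclideanSpace ℝ (Fin n)) + x) μ ''
          voronoiCell M.points ((l : EuclideanSpace ℝ (Fin n)) + x) := by
  rw [voronoiCell_vadd (add_mem_points_iff l.2)]
  simp only [← image_vadd, image_image]
  refine image_congr fun z _ => ?_
  simp only [AffineMap.homothety_apply, vsub_eq_sub, vadd_eq_add, Submodule.vadd_def,
    add_sub_add_left_eq_sub]
  abel

theorem contractedCells_vadd (l : M.lattice) (μ : ℝ) :
    l +ᵥ M.contractedCells μ = M.contractedCells μ := by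
  have key : ∀ l : M.lattice, l +ᵥ M.contractedCells μ ⊆ M.contractedCells μ := by
    intro l
    simp only [contractedCells, vadd_set_iUnion, homothety_image_voronoiCell_vadd]
    refine iUnion₂_subset fun x hx => ?_
    exact subset_biUnion_of_mem (u := fun x => AffineMap.homothety x μ '' voronoiCell M.points x)
      ((add_mem_points_iff l.2 x).2 hx)
  refine Subset.antisymm (key l) ?_
  have h := vadd_set_mono (a := l) (key (-l))
  rwa [vadd_neg_vadd] at h

theorem measurableSet_contractedCells (hcov : ∀ z, ∃ y ∈ M.points, dist z y ≤ 2) (μ : ℝ) :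
    MeasurableSet (M.contractedCells μ) := by
  have := M.discrete
  have := M.full
  have hc : M.points.Countable := by
    have : M.points = ⋃ x ∈ M.shifts, x +ᵥ (M.lattice : Set (EuclideanSpace ℝ (Fin n))) := rfl
    rw [this]
    refine M.shifts.countable_toSet.biUnion fun x _ => ?_
    exact (Set.countable_coe_iff.1 (inferInstance : Countable M.lattice)).image _
  exact .biUnion hc fun x _ => measurableSet_homothety_image_voronoiCell hcov x μ

/-- The contracted Voronoi cells have density `μⁿ`. -/
theorem pow_mul_volume_le_volume_contractedCells_inter
    (hsep : M.points.Pairwise fun x y => 2 ≤ dist x y)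
    (hcov : ∀ z, ∃ y ∈ M.points, dist z y ≤ 2) {μ : ℝ} (hμ : 0 ≤ μ) (hμ1 : μ < 1)
    {F : Set (EuclideanSpace ℝ (Fin n))}
    (hF : IsAddFundamentalDomain M.lattice F (volume : Measure (EuclideanSpace ℝ (Fin n)))) :
    ENNReal.ofReal (μ ^ n) * volume F ≤ volume (M.contractedCells μ ∩ F) := by
  have := M.discrete
  have := M.full
  set C : ℝ → EuclideanSpace ℝ (Fin n) → Set (EuclideanSpace ℝ (Fin n)) := fun r x =>
    AffineMap.homothety x r '' voronoiCell M.points x with hC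
  have hCvadd : ∀ r (l : M.lattice) x, l +ᵥ C r x = C r ((l : EuclideanSpace ℝ (Fin n)) + x) :=
    fun r l x => homothety_image_voronoiCell_vadd l x r
  have hC1 : ∀ x, C 1 x = voronoiCell M.points x := fun x => by simp [hC]
  have hvol : ∀ x, volume (C μ x) = ENNReal.ofReal (μ ^ n) * volume (C 1 x) := fun x => by
    rw [hC1, hC, Measure.addHaar_image_homothety, finrank_euclideanSpace_fin,
      abs_of_nonneg (by positivity)]
  -- Cutting each cell along the lattice translates of `F` turns the sum over shifts into a sum over
  -- all points of pieces inside `F`. For `r = 1` the pieces cover `F`; for `r = μ < 1` they are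
  -- disjoint. The two sums differ by the factor `μⁿ`.
  have hsum : ∀ r, ∑ x : M.shifts, volume (C r x)
      = ∑' p : M.shifts × M.lattice, volume ((p.2 +ᵥ C r p.1) ∩ F) := fun r => by
    rw [ENNReal.tsum_prod (f := fun (x : M.shifts) (l : M.lattice) => volume ((l +ᵥ C r x) ∩ F)),
      tsum_fintype]
    have : VAddInvariantMeasure M.lattice (EuclideanSpace ℝ (Fin n)) volume :=
      ⟨fun l s _ => measure_preimage_add volume (l : EuclideanSpace ℝ (Fin n)) s⟩
    exact Finset.sum_congr rfl fun x _ => hF.measure_eq_tsum _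
  have hmem : ∀ p : M.shifts × M.lattice,
      (p.2 : EuclideanSpace ℝ (Fin n)) + p.1 ∈ M.points := fun p =>
    mem_points.2 ⟨_, p.1.2, _, p.2.2, rfl⟩
  have hinj : ∀ p q : M.shifts × M.lattice, p ≠ q →
      (p.2 : EuclideanSpace ℝ (Fin n)) + p.1 ≠ q.2 + q.1 := by
    rintro ⟨⟨x, hx⟩, ⟨l, hl⟩⟩ ⟨⟨y, hy⟩, ⟨m, hm⟩⟩ hpq h
    replace h : l + x = m + y := h
    have hxy : x = y := M.shifts_incongruent x hx y hy (by
      rw [show x - y = m - l from sub_eq_sub_iff_add_eq_add.2 (by rw [add_comm, h])]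
      exact sub_mem hm hl)
    subst hxy
    have := add_right_cancel h
    subst this
    exact hpq rfl
  have hupper : volume F ≤ ∑ x : M.shifts, volume (C 1 x) := by
    rw [hsum]
    refine le_trans (measure_mono fun z hz => ?_) (measure_iUnion_le _)
    obtain ⟨x, hx, h⟩ := exists_mem_voronoiCell two_pos hsep points_nonempty z
    obtain ⟨x, hxs, l, hl, rfl⟩ := mem_points.1 hx
    refine mem_iUnion.2 ⟨⟨⟨x, hxs⟩, ⟨l, hl⟩⟩, ?_, hz⟩
    rw [hCvadd, hC1]
    exact h
  have hlower : ∑ x : M.shifts, volume (C μ x) ≤ volume (M.contractedCells μ ∩ F) := by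
    rw [hsum, ← measure_iUnion₀]
    · refine measure_mono (iUnion_subset fun p => inter_subset_inter_left _ ?_)
      rw [hCvadd]
      exact subset_biUnion_of_mem (u := C μ) (hmem p)
    · intro p q hpq
      refine (Disjoint.mono inter_subset_left inter_subset_left ?_).aedisjoint
      rw [hCvadd, hCvadd, Set.disjoint_left]
      rintro _ ⟨z, hz, rfl⟩ ⟨w, hw, hzw⟩
      have h1 := le_dist_homothety_voronoiCell hμ (hmem p) (hmem q) hz hw
      have h2 := hsep (hmem p) (hmem q) (hinj p q hpq)
      rw [hzw, dist_self] at h1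
      nlinarith
    · intro p
      rw [hCvadd]
      exact (measurableSet_homothety_image_voronoiCell hcov _ μ).nullMeasurableSet.inter
        hF.nullMeasurableSet
  calc ENNReal.ofReal (μ ^ n) * volume F
      ≤ ENNReal.ofReal (μ ^ n) * ∑ x : M.shifts, volume (C 1 x) := by gcongr
    _ = ∑ x : M.shifts, volume (C μ x) := by simp only [hvol, Finset.mul_sum]
    _ ≤ _ := hlower

/-- Some translate of the contracted cells contains a proportion of at least `μⁿ` of a given finite
set of points. -/
theorem exists_translate_card_le
    (hsep : M.points.Pairwise fun x y => 2 ≤ dist x y)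
    (hcov : ∀ z, ∃ y ∈ M.points, dist z y ≤ 2) {μ : ℝ} (hμ : 0 ≤ μ) (hμ1 : μ < 1)
    (U : Finset (EuclideanSpace ℝ (Fin n))) :
    ∃ t : EuclideanSpace ℝ (Fin n),
      ∃ W ⊆ U, (∀ p ∈ W, p + t ∈ M.contractedCells μ) ∧ μ ^ n * U.card ≤ W.card := by
  classical
  have := M.discrete
  have := M.full
  have := ZLattice.module_free ℝ M.lattice
  have := ZLattice.module_finite ℝ M.lattice
  let b := Module.Free.chooseBasis ℤ M.lattice
  set F := ZSpan.fundamentalDomain (b.ofZLatticeBasis ℝ M.lattice)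
  have hF : IsAddFundamentalDomain M.lattice F
      (volume : Measure (EuclideanSpace ℝ (Fin n))) := ZLattice.isAddFundamentalDomain b volume
  have hF0 : volume F ≠ 0 := ZSpan.measure_fundamentalDomain_ne_zero _
  have hFtop : volume F ≠ ∞ := (ZSpan.fundamentalDomain_isBounded _).measure_lt_top.ne
  set S := M.contractedCells μ
  have hS : MeasurableSet S := measurableSet_contractedCells hcov μ
  -- `f t` counts the points of `U` that translation by `t` brings into `S`; some `t` does at least
  -- as well as the average over `F`.
  set f : EuclideanSpace ℝ (Fin n) → ℝ≥0∞ := fun t =>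
    ∑ p ∈ U, ((p + ·) ⁻¹' S).indicator 1 t with hf
  have hSp : ∀ p : EuclideanSpace ℝ (Fin n), MeasurableSet ((p + ·) ⁻¹' S) := fun p =>
    hS.preimage (by fun_prop)
  have hint : ∫⁻ t in F, f t = ∑ p ∈ U, volume ((p + ·) ⁻¹' S ∩ F) := by
    rw [hf, lintegral_finsetSum _ fun p _ => measurable_one.indicator (hSp p)]
    refine Finset.sum_congr rfl fun p _ => ?_
    rw [lintegral_indicator_one (hSp p), Measure.restrict_apply (hSp p)]
  -- The translate of `F` by `p` is again a fundamental domain, so the density bound applies to it.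
  have hle : ∀ p, ENNReal.ofReal (μ ^ n) * volume F ≤ volume ((p + ·) ⁻¹' S ∩ F) := fun p => by
    have h := pow_mul_volume_le_volume_contractedCells_inter hsep hcov hμ hμ1 (hF.vadd_of_comm p)
    rw [measure_vadd] at h
    refine h.trans_eq ?_
    rw [← measure_preimage_add volume p, preimage_inter]
    congr 2
    ext z
    simp [mem_vadd_set_iff_neg_vadd_mem]
  have hfin : ∫⁻ t in F, f t ≠ ∞ := by
    rw [hint]
    exact ENNReal.sum_ne_top.2 fun p _ => (measure_mono inter_subset_right).trans_lt
      hFtop.lt_top |>.ne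
  obtain ⟨t, -, ht⟩ := exists_setLAverage_le hF0 hF.nullMeasurableSet hfin
  refine ⟨t, U.filter fun p => p + t ∈ S, Finset.filter_subset _ _,
    fun p hp => (Finset.mem_filter.1 hp).2, ?_⟩
  have h1 : ENNReal.ofReal (μ ^ n * U.card) ≤ f t := by
    refine le_trans ?_ ht
    rw [setLAverage_eq, ENNReal.le_div_iff_mul_le (.inl hF0) (.inl hFtop), hint,
      ENNReal.ofReal_mul (by positivity), ENNReal.ofReal_natCast, mul_right_comm]
    calc ENNReal.ofReal (μ ^ n) * volume F * U.card
        = ∑ p ∈ U, ENNReal.ofReal (μ ^ n) * volume F := by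
          rw [Finset.sum_const, nsmul_eq_mul, mul_comm]
      _ ≤ _ := Finset.sum_le_sum fun p _ => hle p
  have h2 : f t = ENNReal.ofReal ((U.filter fun p => p + t ∈ S).card : ℝ) := by
    rw [ENNReal.ofReal_natCast, hf, Finset.card_filter, Nat.cast_sum]
    refine Finset.sum_congr rfl fun p _ => ?_
    by_cases h : p + t ∈ S <;> simp [h]
  rw [h2] at h1
  exact (ENNReal.ofReal_le_ofReal_iff (by positivity)).1 h1

end Multilattice

/-- If each finite set has at least the proportion `δ` of its elements in some member of a family,
then a set of `P` elements is covered by `N` members as soon as `(1 - δ) ^ N * P < 1`. -/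
theorem exists_cover_of_proportion {α ι : Type*} {A : ι → Set α} {δ : ℝ} (hδ : δ ≤ 1)
    (h : ∀ U : Finset α, ∃ i, ∃ W ⊆ U, (∀ p ∈ W, p ∈ A i) ∧ δ * U.card ≤ W.card)
    (P : Finset α) (N : ℕ) (hN : (1 - δ) ^ N * P.card < 1) :
    ∃ i : Fin N → ι, ∀ p ∈ P, ∃ j, p ∈ A (i j) := by
  classical
  -- Greedy choice: `U` contains every point still uncovered, and each new member reduces its size
  -- by a factor of at most `1 - δ`. Once the bound drops below 1, `U` is empty.
  have key : ∀ N : ℕ, ∃ i : Fin N → ι, ∃ U ⊆ P, (U.card : ℝ) ≤ (1 - δ) ^ N * P.card ∧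
      ∀ p ∈ P, p ∉ U → ∃ j, p ∈ A (i j) := by
    intro N
    induction N with
    | zero => exact ⟨Fin.elim0, P, subset_rfl, by simp, fun p hp hp' => absurd hp hp'⟩
    | succ N ih =>
      obtain ⟨i, U, hU, hcard, hi⟩ := ih
      obtain ⟨k, W, hWU, hWA, hW⟩ := h U
      refine ⟨Fin.cons k i, U \ W, Finset.sdiff_subset.trans hU, ?_, fun p hp hpU => ?_⟩
      · rw [Finset.cast_card_sdiff hWU, pow_succ']
        have := mul_le_mul_of_nonneg_left hcard (sub_nonneg.2 hδ)
        linarith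
      · by_cases hpU' : p ∈ U
        · have hpW : p ∈ W := by
            by_contra hpW; exact hpU (Finset.mem_sdiff.2 ⟨hpU', hpW⟩)
          exact ⟨0, by simpa using hWA p hpW⟩
        · obtain ⟨j, hj⟩ := hi p hp hpU'
          exact ⟨j.succ, by simpa using hj⟩
  obtain ⟨i, U, -, hcard, hi⟩ := key N
  have hU : U = ∅ := by
    rw [← Finset.card_eq_zero, ← Nat.lt_one_iff]
    exact_mod_cast hcard.trans_lt hN
  exact ⟨i, fun p hp => hi p hp (by simp [hU])⟩

end Density

/-! ### Colouring by translates of the contracted cells -/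

section ChromaticNumber

variable {n : ℕ}

namespace Multilattice

variable {M : Multilattice n}

theorem dist_le_or_le_dist_of_mem_contractedCells
    (hsep : M.points.Pairwise fun x y => 2 ≤ dist x y)
    (hcov : ∀ z, ∃ y ∈ M.points, dist z y ≤ 2) {μ : ℝ} (hμ : 0 ≤ μ) (hμ1 : μ < 1)
    {s t : EuclideanSpace ℝ (Fin n)} (hs : s ∈ M.contractedCells μ)
    (ht : t ∈ M.contractedCells μ) : dist s t ≤ 4 * μ ∨ 2 * (1 - μ) ≤ dist s t := by
  simp only [contractedCells, mem_iUnion, exists_prop] at hs ht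
  obtain ⟨x, hx, z, hz, rfl⟩ := hs
  obtain ⟨y, hy, w, hw, rfl⟩ := ht
  rcases eq_or_ne x y with rfl | hxy
  · left
    have h1 := mem_closedBall.1 (voronoiCell_subset_closedBall hcov x hz)
    have h2 := mem_closedBall.1 (voronoiCell_subset_closedBall hcov x hw)
    have h3 := dist_triangle_right z w x
    have h4 : dist (AffineMap.homothety x μ z) (AffineMap.homothety x μ w) = μ * dist z w := by
      simp only [AffineMap.homothety_apply, vsub_eq_sub, vadd_eq_add]
      rw [dist_add_right, dist_smul₀, dist_sub_right, Real.norm_of_nonneg hμ]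
    rw [h4]
    nlinarith
  · right
    have h1 := le_dist_homothety_voronoiCell hμ hx hy hz hw
    have h2 := hsep hx hy hxy
    nlinarith

/-- The colour of `z` is the index of a translate passing within `η / 2` of `(4/3) z`; the scaling
turns distance 1 into the avoided distance `4/3`. -/
theorem unitDistanceGraph_colorable (hM : M.lattice = cubeLattice n)
    (hsep : M.points.Pairwise fun x y => 2 ≤ dist x y)
    (hcov : ∀ z, ∃ y ∈ M.points, dist z y ≤ 2) {η : ℝ} (hη : 0 < η) (hη3 : η ≤ 1 / 3)
    {m N : ℕ} (hm : 0 < m) (hmη : 2 / m * √n ≤ η / 2)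
    (hN : (1 - (1 / 3 - η) ^ n) ^ N * (m : ℝ) ^ n < 1) :
    (unitDistanceGraph n).Colorable N := by
  set μ := 1 / 3 - η with hμdef
  have hμ : 0 ≤ μ := by linarith
  have hμ1 : μ < 1 := by linarith
  have hpow : μ ^ n ≤ 1 := pow_le_one₀ hμ hμ1.le
  obtain ⟨P, hPcard, hP⟩ := exists_finset_dense_mod_cubeLattice n hm
  have hPN : (1 - μ ^ n) ^ N * P.card < 1 := by
    refine lt_of_le_of_lt ?_ hN
    exact mul_le_mul_of_nonneg_left (by exact_mod_cast hPcard)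
      (pow_nonneg (sub_nonneg.2 hpow) _)
  obtain ⟨t, ht⟩ := exists_cover_of_proportion (A := fun t => {p | p + t ∈ M.contractedCells μ})
    hpow (exists_translate_card_le hsep hcov hμ hμ1) P N hPN
  have hcolor : ∀ z : EuclideanSpace ℝ (Fin n), ∃ j, ∃ s ∈ M.contractedCells μ,
      dist ((4 / 3 : ℝ) • z + t j) s ≤ η / 2 := fun z => by
    obtain ⟨p, hp, l, hl, hd⟩ := hP ((4 / 3 : ℝ) • z)
    obtain ⟨j, hj⟩ := ht p hp
    refine ⟨j, l + (p + t j), ?_, ?_⟩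
    · rw [← contractedCells_vadd ⟨l, hM ▸ hl⟩ μ]
      exact vadd_mem_vadd_set (a := (⟨l, hM ▸ hl⟩ : M.lattice)) hj
    · rw [← add_assoc, dist_add_right]
      exact hd.trans hmη
  choose c s hs hd using hcolor
  have hcol : (unitDistanceGraph n).Coloring (Fin N) := by
    refine SimpleGraph.Coloring.mk c fun {z w} hzw hc => ?_
    have h1 : dist ((4 / 3 : ℝ) • z + t (c z)) ((4 / 3 : ℝ) • w + t (c w)) = 4 / 3 := by
      have hzw : dist z w = 1 := hzw
      rw [hc, dist_add_right, dist_smul₀, hzw]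
      norm_num
    have h2 := dist_triangle4 (s z) ((4 / 3 : ℝ) • z + t (c z)) ((4 / 3 : ℝ) • w + t (c w)) (s w)
    have h3 := dist_triangle4 ((4 / 3 : ℝ) • z + t (c z)) (s z) (s w)
      ((4 / 3 : ℝ) • w + t (c w))
    have h4 := hd z
    have h5 := hd w
    rw [dist_comm (s z) (_ + _), h1] at h2
    rw [dist_comm (s w) (_ + _), h1] at h3
    -- The distance of `s z` and `s w` is within `η` of `4/3`, but `4μ = 4/3 - 4η` and `2(1 - μ) =
    -- 4/3 + 2η`.
    rcases dist_le_or_le_dist_of_mem_contractedCells hsep hcov hμ hμ1 (hs z) (hs w) with h | h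
    · linarith
    · linarith
  simpa using hcol.colorable

end Multilattice

/-! ### Quantitative estimates and the limit -/

theorem one_third_pow_le (hn : 1 ≤ n) :
    (1 / 3 : ℝ) ^ n / 3 ≤ (1 / 3 - 1 / (3 * ((n : ℝ) + 1))) ^ n := by
  have hn' : (0 : ℝ) < n := by exact_mod_cast hn
  have h1 : (1 + 1 / (n : ℝ)) ^ n ≤ 3 := by
    calc (1 + 1 / (n : ℝ)) ^ n ≤ Real.exp (1 / n) ^ n := by
          refine pow_le_pow_left₀ (by positivity) ?_ n
          rw [add_comm]; exact Real.add_one_le_exp _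
      _ = Real.exp 1 := by rw [← Real.exp_nat_mul, mul_one_div_cancel hn'.ne']
      _ ≤ 3 := Real.exp_one_lt_three.le
  -- Shrinking `1/3` by `1 / (3(n + 1))` is division by `1 + 1/n`, so the `n`-th power loses a
  -- factor of at most `e < 3`.
  have h2 : (1 / 3 : ℝ) = (1 / 3 - 1 / (3 * ((n : ℝ) + 1))) * (1 + 1 / n) := by
    field_simp
    ring
  have h3 : 0 ≤ 1 / 3 - 1 / (3 * ((n : ℝ) + 1)) := by
    rw [sub_nonneg]
    exact one_div_le_one_div_of_le (by norm_num) (by linarith)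
  rw [div_le_iff₀ three_pos]
  calc (1 / 3 : ℝ) ^ n = (1 / 3 - 1 / (3 * ((n : ℝ) + 1))) ^ n * (1 + 1 / n) ^ n := by
        rw [← mul_pow, ← h2]
    _ ≤ _ := mul_le_mul_of_nonneg_left h1 (pow_nonneg h3 _)

/-- Since `(1 - δ)^N ≤ exp(-Nδ)`, any `N` exceeding `log C / δ` suffices. -/
theorem exists_nat_one_sub_pow_mul_lt_one {δ C : ℝ} (hδ : 0 < δ) (hδ1 : δ ≤ 1) (hC : 1 ≤ C) :
    ∃ N : ℕ, (1 - δ) ^ N * C < 1 ∧ (N : ℝ) ≤ Real.log C / δ + 1 := by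
  refine ⟨⌊Real.log C / δ⌋₊ + 1, ?_, ?_⟩
  · have h := Nat.lt_floor_add_one (Real.log C / δ)
    rw [div_lt_iff₀ hδ] at h
    set N := ⌊Real.log C / δ⌋₊ + 1
    have h1 : (1 - δ) ^ N ≤ Real.exp (-(N * δ)) := by
      rw [← mul_neg, Real.exp_nat_mul]
      refine pow_le_pow_left₀ (by linarith) ?_ N
      linarith [Real.add_one_le_exp (-δ)]
    have h2 : C = Real.exp (Real.log C) := (Real.exp_log (by linarith)).symm
    calc (1 - δ) ^ N * C ≤ Real.exp (-(N * δ)) * Real.exp (Real.log C) := by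
          rw [← h2]; exact mul_le_mul_of_nonneg_right h1 (by linarith)
      _ < 1 := by
          rw [← Real.exp_add, Real.exp_lt_one_iff]
          have : (N : ℝ) = (⌊Real.log C / δ⌋₊ : ℝ) + 1 := by push_cast [N]; rfl
          rw [this]; linarith
  · push_cast
    linarith [Nat.floor_le (div_nonneg (Real.log_nonneg hC) hδ.le)]

/-- An explicit form of the bound `χ(ℝⁿ) ≤ (3 + o(1))ⁿ`. -/
theorem exists_colorable_le (hn : 1 ≤ n) :
    ∃ N : ℕ, (unitDistanceGraph n).Colorable N ∧ (N : ℝ) ≤ 37 * ((n : ℝ) + 1) ^ 3 * 3 ^ n := by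
  obtain ⟨M, hM, -, -, hsep, hcov⟩ := exists_multilattice_cubeLattice hn
  have hn' : (1 : ℝ) ≤ n := by exact_mod_cast hn
  set η : ℝ := 1 / (3 * ((n : ℝ) + 1)) with hη
  have hη0 : 0 < η := by positivity
  have hη3 : η < 1 / 3 := one_div_lt_one_div_of_lt (by norm_num) (by linarith)
  -- With `√n ≤ n + 1` this makes the grid error at most `1 / (6(n + 1)) = η / 2`.
  set m : ℕ := 12 * (n + 1) ^ 2 with hm
  have hm0 : 0 < m := by positivity
  have hmr : (m : ℝ) = 12 * ((n : ℝ) + 1) ^ 2 := by push_cast [hm]; rfl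
  have hmη : 2 / m * √n ≤ η / 2 := by
    have h1 : √(n : ℝ) ≤ n + 1 := by
      rw [Real.sqrt_le_left (by linarith)]; nlinarith
    calc 2 / (m : ℝ) * √n ≤ 2 / m * (n + 1) := by gcongr
      _ = η / 2 := by rw [hmr, hη]; field_simp; norm_num
  set δ : ℝ := (1 / 3 - η) ^ n with hδ
  have hδ3 : (1 / 3 : ℝ) ^ n / 3 ≤ δ := one_third_pow_le hn
  have hδ0 : 0 < δ := pow_pos (by linarith) n
  have hδ1 : δ ≤ 1 := pow_le_one₀ (by linarith) (by linarith)
  have hm1 : (1 : ℝ) ≤ m := by exact_mod_cast hm0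
  obtain ⟨N, hN, hNle⟩ := exists_nat_one_sub_pow_mul_lt_one hδ0 hδ1 (one_le_pow₀ hm1 (n := n))
  refine ⟨N, M.unitDistanceGraph_colorable hM hsep hcov hη0 hη3.le hm0 hmη hN, hNle.trans ?_⟩
  -- The crude `log m ≤ m` costs only a polynomial factor, which disappears in the `n`-th root.
  have hlog : Real.log ((m : ℝ) ^ n) ≤ 12 * ((n : ℝ) + 1) ^ 3 := by
    rw [Real.log_pow]
    calc (n : ℝ) * Real.log m ≤ (n + 1) * m :=
          mul_le_mul (by linarith) (Real.log_le_self (by positivity)) (Real.log_nonneg hm1)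
            (by linarith)
      _ = _ := by rw [hmr]; ring
  have hinv : Real.log ((m : ℝ) ^ n) / δ ≤ 12 * ((n : ℝ) + 1) ^ 3 / ((1 / 3 : ℝ) ^ n / 3) :=
    div_le_div₀ (by positivity) hlog (by positivity) hδ3
  have heq : 12 * ((n : ℝ) + 1) ^ 3 / ((1 / 3 : ℝ) ^ n / 3) = 36 * ((n : ℝ) + 1) ^ 3 * 3 ^ n := by
    rw [one_div, inv_pow]; field_simp; norm_num
  have hone : (1 : ℝ) ≤ ((n : ℝ) + 1) ^ 3 * 3 ^ n :=
    one_le_mul_of_one_le_of_one_le (one_le_pow₀ (by linarith)) (one_le_pow₀ (by norm_num))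
  linarith

theorem tendsto_polynomial_rpow_one_div :
    Tendsto (fun n : ℕ => (37 * ((n : ℝ) + 1) ^ 3) ^ (1 / (n : ℝ))) atTop (𝓝 1) := by
  have h1 : Tendsto (fun n : ℕ => (37 : ℝ) ^ (1 / (n : ℝ))) atTop (𝓝 1) := by
    have h := (Real.continuous_const_rpow (a := 37) (by norm_num)).tendsto 0
    rw [Real.rpow_zero] at h
    exact h.comp tendsto_one_div_atTop_nhds_zero_nat
  -- The exponent is `3 / n`, written in terms of `n + 1` to fit `tendsto_rpow_div_mul_add`.
  have h2 : Tendsto (fun n : ℕ => ((n : ℝ) + 1) ^ (3 / (1 * ((n : ℝ) + 1) + -1))) atTop (𝓝 1) :=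
    (tendsto_rpow_div_mul_add 3 1 (-1) zero_ne_one).comp
      (tendsto_atTop_add_const_right _ 1 tendsto_natCast_atTop_atTop)
  have h3 := h1.mul h2
  rw [mul_one] at h3
  refine h3.congr fun n => ?_
  rw [Real.mul_rpow (by norm_num) (by positivity), ← Real.rpow_natCast ((n : ℝ) + 1) 3,
    ← Real.rpow_mul (by positivity)]
  congr 2
  push_cast
  ring

theorem chromaticNumberSpace_le_of_colorable {N : ℕ} {b : ℝ}
    (h : (unitDistanceGraph n).Colorable N) (hb : (N : ℝ) ≤ b) :
    (chromaticNumberSpace n : ℝ≥0∞) ≤ ENNReal.ofReal b := by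
  calc (chromaticNumberSpace n : ℝ≥0∞) ≤ ((N : ℕ∞) : ℝ≥0∞) :=
        ENat.toENNReal_le.2 h.chromaticNumber_le
    _ = ENNReal.ofReal N := by simp
    _ ≤ _ := ENNReal.ofReal_le_ofReal hb

theorem exists_tendsto_chromaticNumberSpace_le :
    ∃ ε : ℕ → ℝ, Tendsto ε atTop (𝓝 0) ∧
      ∀ n : ℕ, (chromaticNumberSpace n : ℝ≥0∞) ≤ ENNReal.ofReal ((3 + ε n) ^ n) := by
  -- For `n ≥ 1` this choice makes `(3 + ε n)ⁿ` exactly the explicit bound `37 (n + 1)³ 3ⁿ`.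
  refine ⟨fun n => 3 * ((37 * ((n : ℝ) + 1) ^ 3) ^ (1 / (n : ℝ)) - 1), ?_, fun n => ?_⟩
  · simpa using (tendsto_polynomial_rpow_one_div.sub_const 1).const_mul 3
  · rcases Nat.eq_zero_or_pos n with rfl | hn
    · refine chromaticNumberSpace_le_of_colorable (N := 1) ?_ (by simp)
      have hcol : (unitDistanceGraph 0).Coloring (Fin 1) :=
        SimpleGraph.Coloring.mk (fun _ => 0) fun {z w} hzw =>
          absurd (Subsingleton.elim z w) hzw.ne
      simpa using hcol.colorable
    · obtain ⟨N, hN, hle⟩ := exists_colorable_le hn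
      refine chromaticNumberSpace_le_of_colorable hN (hle.trans_eq ?_)
      have hn' : (n : ℝ) ≠ 0 := by exact_mod_cast hn.ne'
      rw [show ∀ a : ℝ, 3 + 3 * (a - 1) = a * 3 by intro a; ring, mul_pow, ← Real.rpow_natCast
        (_ ^ (1 / (n : ℝ))) n, ← Real.rpow_mul (by positivity), one_div_mul_cancel hn',
        Real.rpow_one]

end ChromaticNumber

/-! ### The corollary -/

theorem mainTheorem2 :
    (∃ c : ℝ, 0 < c ∧ ∀ n : ℕ, 1 ≤ n →
      ∃ k : ℕ, (k : ℝ) ≤ (n : ℝ) ^ (c * (n : ℝ)) ∧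
        (∃ M : Multilattice n, M.lattice = cubeLattice n ∧ M.q = k ∧
          (∀ x ∈ M.shifts, ∀ y ∈ M.shifts, x ≠ y →
            Disjoint ((cubeLattice n : Set (EuclideanSpace ℝ (Fin n))) + closedBall x 1)
              ((cubeLattice n : Set (EuclideanSpace ℝ (Fin n))) + closedBall y 1)) ∧
          (⋃ z ∈ M.points, closedBall z 2) = univ) ∧
        tilingParameter (closedBall (0 : EuclideanSpace ℝ (Fin n)) 1) k ≤ 2) ∧
    (∃ ε : ℕ → ℝ, Tendsto ε atTop (𝓝 0) ∧
      ∀ n : ℕ, (chromaticNumberSpace n : ℝ≥0∞) ≤ ENNReal.ofReal ((3 + ε n) ^ n)) := by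
  refine ⟨⟨1, one_pos, fun n hn => ?_⟩, exists_tendsto_chromaticNumberSpace_le⟩
  obtain ⟨M, hM, hq, hs, hsep, hcov⟩ := exists_multilattice_cubeLattice hn
  refine ⟨M.q, ?_, ⟨M, hM, rfl, fun x hx y hy hxy => hs.disjoint hx hy hxy, ?_⟩,
    M.tilingParameter_closedBall_le_two hsep hcov⟩
  · rw [one_mul, Real.rpow_natCast]
    exact_mod_cast hq
  · refine eq_univ_of_forall fun z => ?_
    obtain ⟨y, hy, h⟩ := hcov z
    exact mem_biUnion hy h
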